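/- For a symmetric positive definite $M\in\mathbb R^{d\times d}$ put $\langle u,v\rangle_M=u^{\mathsf T}Mv$, $\|u\|_M=\sqrt{\langle u,u\rangle_M}$, and for $1\le i\le d$ let $$\lambda_i(M)=\min\{\|u_i\|_M:\ (u_1,\dots,u_i)\in(\mathbb Z^d)^i \text{ linearly independent},\ \|u_1\|_M\le\cdots\le\|u_i\|_M\}.$$ An $M$-reduced basis is a family $u_1,\dots,u_d\in\mathbb Z^d$ with $|\det(u_1,\dots,u_d)|=1$ and $\|u_i\|_M=\lambda_i(M)$ for all $i$. An $M$-reduced mesh is a finite conforming family $\mathcal T$ of $d$-simplices whose union is a neighbourhood of $0$, such that each simplex has all its vertices in $\mathbb Z^d$, has volume $1/d!$, has $0$ as a vertex, and has other vertices $v_1,\dots,v_d$ with $\langle v_i,v_j\rangle_M\ge0$ for all $i,j$. For a family $\mathcal T$ of simplices let $r_M(\mathcal T)=\max_{T\in\mathcal T}\max_{z\in T}\|z\|_M$. **Theorem.** (a) Let $1\le d\le 3$, let $M$ be symmetric positive definite, let $(u_i)$ be an $M$-reduced basis, and let $\mathcal T$ be an $M$-reduced mesh all of whose vertices are of the form $\varepsilon_1u_1+\cdots+\varepsilon_du_d$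 with $\varepsilon_i\in\{-1,0,1\}$. Then $r_M(\mathcal T)\le d\,\lambda_d(M)$. (b) For $d=2,3$, let $w_1,\dots,w_d$ be the elements of an $M$-reduced basis, up to order and signs, and let $b=(b_0,\dots,b_d)$ be $(w_1,w_2,-w_1-w_2)$ if $d=2$, and one of $(w_1,w_2,w_3,-w_1-w_2-w_3)$, $(w_1-w_2,w_2-w_3,w_3,-w_1)$ if $d=3$, such that $\langle b_i,b_j\rangle_M\le0$ for all $i\ne j$. Let $\mathcal T$ consist of the $(d+1)!$ simplices with vertices $0,\ b_{\sigma(0)},\ b_{\sigma(0)}+b_{\sigma(1)},\ \dots,\ b_{\sigma(0)}+\cdots+b_{\sigma(d-1)}$, where $\sigma$ runs over the permutations of $\{0,\dots,d\}$. Then $r_M(\mathcal T)\le K_d\,\lambda_d(M)$ with $K_2=2$, $K_3=3$. (c) For $d=4$ and an $M$-reduced basis $(u_1,\dots,u_4)$, let $\mathcal T$ consist of the simplices with vertices $$(0,\ v_1,\ v_1+v_2,\ v_1+v_2+v_3,\ 2v_1+v_2+v_3+v_4)$$ and $$(0,\ v_1+v_2,\ v_1+v_2+v_3,\ v_1+v_2+v_3+v_4,\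 2v_1+v_2+v_3+v_4),$$ where $(v_1,\dots,v_4)$ runs over all permutations of $(\varepsilon_1u_1,\dots,\varepsilon_4u_4)$ with all signs $\varepsilon_i\in\{-1,1\}$. Then $r_M(\mathcal T)\le K_4\,\lambda_4(M)$ with $K_4=5$. (d) For every $d\ge1$ there is a constant $C_d$ such that for every symmetric positive definite $M\in\mathbb R^{d\times d}$ the function $R\mapsto\lambda_d(R^{\mathsf T}MR)$ is integrable for the Haar probability measure of the orthogonal group $\mathcal O_d$, and $$\int_{\mathcal O_d}\lambda_d(R^{\mathsf T}MR)\,dR\le C_d\,(\det M)^{\frac1{2d}}.$$ -/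

import Mathlib

open MeasureTheory Topology

namespace FastMarching

noncomputable section

/-- The inclusion of the lattice `ℤᵈ` in `ℝᵈ`. -/
def toR {d : ℕ} (z : Fin d → ℤ) : Fin d → ℝ := fun i => (z i : ℝ)

/-- The scalar product `⟨u, v⟩_M = uᵀ M v`. -/
def mdot {d : ℕ} (M : Matrix (Fin d) (Fin d) ℝ) (u v : Fin d → ℝ) : ℝ :=
  dotProduct u (M.mulVec v)

/-- The norm `‖u‖_M = √⟨u, u⟩_M`. -/
def mnorm {d : ℕ} (M : Matrix (Fin d) (Fin d) ℝ) (u : Fin d → ℝ) : ℝ :=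
  Real.sqrt (mdot M u u)

/-- The successive Minkowski minima `λ_k(M)`, `1 ≤ k ≤ d`: the least value of `‖u_k‖_M` over the
free families `(u_1, …, u_k)` of `ℤᵈ` with `‖u_1‖_M ≤ ⋯ ≤ ‖u_k‖_M`. The value at `k = 0` is a
convention that is not used. -/
def minkowskiMin {d : ℕ} (M : Matrix (Fin d) (Fin d) ℝ) : ℕ → ℝ
  | 0 => 0
  | k + 1 => sInf {r : ℝ | ∃ u : Fin (k + 1) → (Fin d → ℤ),
      LinearIndependent ℤ u ∧ Monotone (fun i => mnorm M (toR (u i))) ∧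
      r = mnorm M (toR (u (Fin.last k)))}

/-- An `M`-reduced basis: `u_1, …, u_d ∈ ℤᵈ` with `|det (u_1, …, u_d)| = 1` and
`‖u_i‖_M = λ_i(M)`. -/
structure IsReducedBasis {d : ℕ} (M : Matrix (Fin d) (Fin d) ℝ) (u : Fin d → (Fin d → ℤ)) :
    Prop where
  abs_det : |(Matrix.of u).det| = 1
  norm_eq : ∀ i : Fin d, mnorm M (toR (u i)) = minkowskiMin M ((i : ℕ) + 1)

/-- An `M`-reduced mesh. A simplex is given by the set of its vertices, and a mesh by the set of
its simplices of full dimension. -/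
structure IsReducedMesh {d : ℕ} (M : Matrix (Fin d) (Fin d) ℝ) (T : Set (Set (Fin d → ℝ))) :
    Prop where
  finite : T.Finite
  card : ∀ S ∈ T, S.ncard = d + 1
  affineIndependent : ∀ S ∈ T, AffineIndependent ℝ (Subtype.val : S → (Fin d → ℝ))
  conforming : ∀ S ∈ T, ∀ S' ∈ T, convexHull ℝ S ∩ convexHull ℝ S' = convexHull ℝ (S ∩ S')
  nhds_zero : (⋃ S ∈ T, convexHull ℝ S) ∈ 𝓝 (0 : Fin d → ℝ)
  lattice : ∀ S ∈ T, ∀ v ∈ S, ∃ z : Fin d → ℤ, v = toR z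
  volume_eq : ∀ S ∈ T, volume (convexHull ℝ S) = ENNReal.ofReal (1 / (d.factorial : ℝ))
  zero_mem : ∀ S ∈ T, (0 : Fin d → ℝ) ∈ S
  acute : ∀ S ∈ T, ∀ v ∈ S, ∀ w ∈ S, v ≠ 0 → w ≠ 0 → 0 ≤ mdot M v w

/-- The radius `r_M` of one simplex with vertex set `S`: the largest `‖z‖_M`, `z` in the simplex. -/
def simplexRadius {d : ℕ} (M : Matrix (Fin d) (Fin d) ℝ) (S : Set (Fin d → ℝ)) : ℝ :=
  sSup (mnorm M '' convexHull ℝ S)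

/-- The bounding radius `r_M(T)`: the largest radius of a simplex of the mesh. -/
def boundingRadius {d : ℕ} (M : Matrix (Fin d) (Fin d) ℝ) (T : Set (Set (Fin d → ℝ))) : ℝ :=
  sSup (simplexRadius M '' T)

/-- All vertices of `T` have the form `ε_1 u_1 + ⋯ + ε_d u_d`, `ε_i ∈ {-1, 0, 1}`. -/
def HasSignVertices {d : ℕ} (u : Fin d → (Fin d → ℤ)) (T : Set (Set (Fin d → ℝ))) : Prop :=
  ∀ S ∈ T, ∀ v ∈ S, ∃ ε : Fin d → ℤ,
    (∀ i, ε i = -1 ∨ ε i = 0 ∨ ε i = 1) ∧ v = toR (∑ i, ε i • u i)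

/-- `w` is a permutation of `(ε_1 u_1, …, ε_d u_d)` for some signs `ε_i ∈ {-1, 1}`. -/
def IsSignedPerm {d : ℕ} (u w : Fin d → (Fin d → ℤ)) : Prop :=
  ∃ (σ : Equiv.Perm (Fin d)) (ε : Fin d → ℤ),
    (∀ i, ε i = -1 ∨ ε i = 1) ∧ ∀ i, w i = ε (σ i) • u (σ i)

/-- The `d + 1` vectors `b_0, …, b_d` make pairwise obtuse (or right) angles for `⟨·, ·⟩_M`. -/
def IsObtuse {d : ℕ} (M : Matrix (Fin d) (Fin d) ℝ) (b : Fin (d + 1) → (Fin d → ℤ)) : Prop :=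
  ∀ i j, i ≠ j → mdot M (toR (b i)) (toR (b j)) ≤ 0

/-- The `(d + 1)!` simplices with vertices
`0, b_σ(0), b_σ(0) + b_σ(1), …, b_σ(0) + ⋯ + b_σ(d-1)`, for the permutations `σ` of `{0, …, d}`. -/
def superbaseMesh {d : ℕ} (b : Fin (d + 1) → (Fin d → ℤ)) : Set (Set (Fin d → ℝ)) :=
  Set.range fun σ : Equiv.Perm (Fin (d + 1)) =>
    Set.range fun k : Fin (d + 1) => toR (∑ j ∈ Finset.Iio k, b (σ j))

/-- Dimension two: the six triangles with vertices `0, b_i, b_i + b_j`, where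
`b = (w_1, w_2, -w_1 - w_2)` and `w_1, w_2` are, up to order and signs, the elements of an
`M`-reduced basis, such that `⟨w_1, w_2⟩_M ≤ 0`. -/
def IsConstructedMesh₂ (M : Matrix (Fin 2) (Fin 2) ℝ) (T : Set (Set (Fin 2 → ℝ))) : Prop :=
  ∃ u w, IsReducedBasis M u ∧ IsSignedPerm u w ∧
    IsObtuse M ![w 0, w 1, -(w 0 + w 1)] ∧
    T = superbaseMesh ![w 0, w 1, -(w 0 + w 1)]

/-- Dimension three: the 24 tetrahedra with vertices `0, b_i, b_i + b_j, b_i + b_j + b_k`, where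
`w_1, w_2, w_3` are, up to order and signs, the elements of an `M`-reduced basis, and where `b` is
`(w_1, w_2, w_3, -w_1 - w_2 - w_3)` or `(w_1 - w_2, w_2 - w_3, w_3, -w_1)`, chosen to have pairwise
nonpositive scalar products. -/
def IsConstructedMesh₃ (M : Matrix (Fin 3) (Fin 3) ℝ) (T : Set (Set (Fin 3 → ℝ))) : Prop :=
  ∃ u w b, IsReducedBasis M u ∧ IsSignedPerm u w ∧
    (b = ![w 0, w 1, w 2, -(w 0 + w 1 + w 2)] ∨ b = ![w 0 - w 1, w 1 - w 2, w 2, -w 0]) ∧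
    IsObtuse M b ∧ T = superbaseMesh b

/-- Dimension four: the 768 simplices attached to the basis `u`, two for each signed permutation
`v` of `u`. -/
def mesh₄ (u : Fin 4 → (Fin 4 → ℤ)) : Set (Set (Fin 4 → ℝ)) :=
  {S | ∃ v, IsSignedPerm u v ∧
    (S = toR '' {0, v 0, v 0 + v 1, v 0 + v 1 + v 2, (2 : ℤ) • v 0 + v 1 + v 2 + v 3} ∨
     S = toR '' {0, v 0 + v 1, v 0 + v 1 + v 2, v 0 + v 1 + v 2 + v 3,
       (2 : ℤ) • v 0 + v 1 + v 2 + v 3})}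

/-- The Borel sigma-algebra of `O_d` (a subspace of the matrices, with the product topology). -/
instance orthogonalMeasurableSpace (d : ℕ) :
    MeasurableSpace (Matrix.orthogonalGroup (Fin d) ℝ) := borel _

instance orthogonalBorelSpace (d : ℕ) : BorelSpace (Matrix.orthogonalGroup (Fin d) ℝ) := ⟨rfl⟩

instance orthogonalTopologicalGroup (d : ℕ) :
    IsTopologicalGroup (Matrix.orthogonalGroup (Fin d) ℝ) :=
  inferInstanceAs (IsTopologicalGroup (unitary (Matrix (Fin d) (Fin d) ℝ)))

instance orthogonalCompactSpace (d : ℕ) : CompactSpace (Matrix.orthogonalGroup (Fin d) ℝ) := by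
  suffices h : IsCompact (Matrix.orthogonalGroup (Fin d) ℝ : Set (Matrix (Fin d) (Fin d) ℝ)) from
    isCompact_iff_compactSpace.mp h
  have hK : IsCompact (Set.pi Set.univ fun _ : Fin d => Set.pi Set.univ fun _ : Fin d =>
      Set.Icc (-1 : ℝ) 1) :=
    isCompact_univ_pi fun _ => isCompact_univ_pi fun _ => isCompact_Icc
  refine IsCompact.of_isClosed_subset hK ?_ ?_
  · have h : (Matrix.orthogonalGroup (Fin d) ℝ : Set (Matrix (Fin d) (Fin d) ℝ)) =
        {A | A * star A = 1} := by
      ext A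
      exact Matrix.mem_unitaryGroup_iff
    rw [h]
    exact isClosed_eq (by fun_prop) continuous_const
  · intro A hA i _ j _
    have h := entry_norm_bound_of_unitary hA i j
    rw [Real.norm_eq_abs] at h
    exact abs_le.mp h

/-- The Haar probability measure of the orthogonal group `O_d`. -/
def orthogonalHaar (d : ℕ) : Measure (Matrix.orthogonalGroup (Fin d) ℝ) :=
  Measure.haarMeasure ⊤

instance orthogonalHaar_isHaar (d : ℕ) : (orthogonalHaar d).IsHaarMeasure :=
  inferInstanceAs (Measure.haarMeasure ⊤).IsHaarMeasure

instance orthogonalHaar_isProbability (d : ℕ) : IsProbabilityMeasure (orthogonalHaar d) :=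
  ⟨Measure.haarMeasure_self⟩

end

end FastMarching

/-! Mesh bounds: a norm is convex, so its maximum over a simplex is attained at a vertex. Every
vertex is an integer combination of vectors of norm at most `λ_d`, and the triangle inequality
bounds it by `λ_d` times the sum of the absolute values of the coefficients (`mnorm_sum_smul_le`).
That sum is at most `d`, 2, 3 or 5 in the respective cases.

Average: write `d = k + 1` and `M = A² SᵀS` with `|det S| = 1`, so that `A = (det M)^(1/(2d))`. The
norm of `RᵀMR` is `A` times the Euclidean length of `SRx`, and `SRℤᵈ` is a lattice of covolume 1. If
its nonzero vectors have length at least `a`, a weak second theorem of Minkowski gives `λ_d ≤ c A /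
a^k` (`minkowskiMin_le_of_forall_le`). Hence `λ_d` is at most `c A` times 1 plus the sum of `F(SRz)`
over nonzero `z`, where `F(y) = ‖y‖^(-k)` is cut off outside the unit ball
(`ofReal_minkowskiMin_le_tsum`). A Siegel-type inequality bounds the mean of this sum over `R` by a
multiple of the integral of `F ∘ S` (`tsum_lintegral_orthogonal_le`). This equals the integral of
`F`, since `|det S| = 1`, and it is finite because `k < d`. The bound no longer depends on `S`. -/

namespace FastMarching

open Matrix
open scoped MatrixOrder

/-! ### The `M`-norm and its convexity. -/

section Norm

variable {d : ℕ}

/-- The inclusion of `ℤᵈ` in `ℝᵈ` as a `ℤ`-linear map. -/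
def toRLin (d : ℕ) : (Fin d → ℤ) →ₗ[ℤ] (Fin d → ℝ) :=
  (Int.castAddHom ℝ).toIntLinearMap.compLeft (Fin d)

lemma toRLin_apply (z : Fin d → ℤ) : toRLin d z = toR z := rfl

lemma toR_injective : Function.Injective (toR : (Fin d → ℤ) → (Fin d → ℝ)) := by
  intro a b h
  ext i
  exact Int.cast_injective (α := ℝ) (congrFun h i)

lemma toR_sum_smul {ι : Type*} (s : Finset ι) (c : ι → ℤ) (u : ι → (Fin d → ℤ)) :
    toR (∑ i ∈ s, c i • u i) = ∑ i ∈ s, (c i : ℝ) • toR (u i) := by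
  rw [← toRLin_apply, map_sum]
  refine Finset.sum_congr rfl fun i _ => ?_
  rw [map_smul, toRLin_apply, Int.cast_smul_eq_zsmul]

/-- A positive definite matrix is `SᵀS` with `S` invertible. -/
lemma exists_eq_transpose_mul_self {M : Matrix (Fin d) (Fin d) ℝ} (hM : M.PosDef) :
    ∃ S : Matrix (Fin d) (Fin d) ℝ, M = Sᵀ * S ∧ S.det ≠ 0 := by
  obtain ⟨S, hS⟩ := (CStarAlgebra.nonneg_iff_eq_star_mul_self).1 hM.posSemidef.nonneg
  have hS' : M = Sᵀ * S := by rw [hS, star_eq_conjTranspose, conjTranspose_eq_transpose_of_trivial]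
  refine ⟨S, hS', fun h => ?_⟩
  have := hM.det_pos
  rw [hS', det_mul, h, mul_zero] at this
  exact lt_irrefl _ this

lemma mnorm_transpose_mul_self (S : Matrix (Fin d) (Fin d) ℝ) (u : Fin d → ℝ) :
    mnorm (Sᵀ * S) u = ‖WithLp.toLp 2 (S *ᵥ u)‖ := by
  rw [mnorm, mdot, EuclideanSpace.norm_eq, ← mulVec_mulVec, dotProduct_mulVec, vecMul_transpose]
  congr 1
  simp [dotProduct, sq]

lemma mnorm_nonneg (M : Matrix (Fin d) (Fin d) ℝ) (u : Fin d → ℝ) : 0 ≤ mnorm M u :=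
  Real.sqrt_nonneg _

/-- The `M`-norm as a seminorm. -/
lemma exists_linearMap_norm_eq_mnorm {M : Matrix (Fin d) (Fin d) ℝ} (hM : M.PosDef) :
    ∃ f : (Fin d → ℝ) →ₗ[ℝ] EuclideanSpace ℝ (Fin d), ∀ u, mnorm M u = ‖f u‖ := by
  obtain ⟨S, rfl, -⟩ := exists_eq_transpose_mul_self hM
  exact ⟨(WithLp.linearEquiv 2 ℝ (Fin d → ℝ)).symm.toLinearMap ∘ₗ S.mulVecLin, fun u =>
    mnorm_transpose_mul_self S u⟩

lemma mnorm_sum_smul_le {M : Matrix (Fin d) (Fin d) ℝ} (hM : M.PosDef) {n : ℕ} {L : ℝ} (hL : 0 ≤ L)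
    {w : Fin n → (Fin d → ℤ)} (hw : ∀ i, mnorm M (toR (w i)) ≤ L) {c : Fin n → ℤ} {K : ℕ}
    (hc : ∑ i, |c i| ≤ K) : mnorm M (toR (∑ i, c i • w i)) ≤ K * L := by
  obtain ⟨f, hf⟩ := exists_linearMap_norm_eq_mnorm hM
  calc mnorm M (toR (∑ i, c i • w i)) = ‖∑ i, (c i : ℝ) • f (toR (w i))‖ := by
        rw [hf, toR_sum_smul, map_sum]
        simp
    _ ≤ ∑ i, ‖(c i : ℝ) • f (toR (w i))‖ := norm_sum_le _ _
    _ ≤ ∑ i, |(c i : ℝ)| * L := by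
        refine Finset.sum_le_sum fun i _ => ?_
        rw [norm_smul, ← hf, Real.norm_eq_abs]
        exact mul_le_mul_of_nonneg_left (hw i) (abs_nonneg _)
    _ = ((∑ i, |c i| : ℤ) : ℝ) * L := by
        push_cast
        rw [Finset.sum_mul]
    _ ≤ K * L := mul_le_mul_of_nonneg_right (by exact_mod_cast hc) hL

lemma boundingRadius_le {M : Matrix (Fin d) (Fin d) ℝ} (hM : M.PosDef)
    {T : Set (Set (Fin d → ℝ))} {r : ℝ} (hr : 0 ≤ r)
    (h : ∀ S ∈ T, ∀ v ∈ S, mnorm M v ≤ r) : boundingRadius M T ≤ r := by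
  obtain ⟨f, hf⟩ := exists_linearMap_norm_eq_mnorm hM
  -- The condition `0 ≤ r` covers an empty supremum, whose value is 0.
  refine Real.sSup_le ?_ hr
  rintro _ ⟨S, hS, rfl⟩
  refine Real.sSup_le ?_ hr
  rintro _ ⟨x, hx, rfl⟩
  have hsub : convexHull ℝ S ⊆ f ⁻¹' Metric.closedBall 0 r := by
    refine convexHull_min (fun v hv => ?_) ((convex_closedBall 0 r).linear_preimage f)
    simpa [← hf] using h S hS v hv
  simpa [← hf] using hsub hx

end Norm

/-! ### Successive minima. -/

section MinkowskiMin

variable {d : ℕ}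

lemma bddBelow_minkowskiSet (M : Matrix (Fin d) (Fin d) ℝ) (k : ℕ) :
    BddBelow {r : ℝ | ∃ u : Fin (k + 1) → (Fin d → ℤ),
      LinearIndependent ℤ u ∧ Monotone (fun i => mnorm M (toR (u i))) ∧
      r = mnorm M (toR (u (Fin.last k)))} := by
  refine ⟨0, ?_⟩
  rintro _ ⟨u, -, -, rfl⟩
  exact mnorm_nonneg _ _

lemma minkowskiMin_nonneg (M : Matrix (Fin d) (Fin d) ℝ) (k : ℕ) : 0 ≤ minkowskiMin M k := by
  cases k with
  | zero => exact le_rfl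
  | succ k =>
    refine Real.sInf_nonneg ?_
    rintro _ ⟨u, -, -, rfl⟩
    exact mnorm_nonneg _ _

/-- A free family can be sorted by increasing norm. -/
lemma exists_sorted (M : Matrix (Fin d) (Fin d) ℝ) {k : ℕ} {u : Fin (k + 1) → (Fin d → ℤ)}
    (hu : LinearIndependent ℤ u) : ∃ σ : Equiv.Perm (Fin (k + 1)),
      mnorm M (toR (u (σ (Fin.last k)))) ∈ {r : ℝ | ∃ u : Fin (k + 1) → (Fin d → ℤ),
      LinearIndependent ℤ u ∧ Monotone (fun i => mnorm M (toR (u i))) ∧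
      r = mnorm M (toR (u (Fin.last k)))} := by
  let f : Fin (k + 1) → ℝ := fun i => mnorm M (toR (u i))
  exact ⟨Tuple.sort f, u ∘ Tuple.sort f, hu.comp _ (Tuple.sort f).injective,
    Tuple.monotone_sort f, rfl⟩

/-- Sorting a free family makes the ordering condition in the definition harmless for upper bounds.
-/
lemma minkowskiMin_le {M : Matrix (Fin d) (Fin d) ℝ} {k : ℕ} {u : Fin (k + 1) → (Fin d → ℤ)}
    (hu : LinearIndependent ℤ u) {L : ℝ} (hL : ∀ i, mnorm M (toR (u i)) ≤ L) :
    minkowskiMin M (k + 1) ≤ L := by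
  obtain ⟨σ, hσ⟩ := exists_sorted M hu
  exact (csInf_le (bddBelow_minkowskiSet M k) hσ).trans (hL _)

lemma linearIndependent_stdBasis (d : ℕ) :
    LinearIndependent ℤ (fun i : Fin d => (Pi.single i 1 : Fin d → ℤ)) := by
  have := (Pi.basisFun ℤ (Fin d)).linearIndependent
  convert this using 2
  · simp
  · exact Subsingleton.elim _ _

/-- This form serves measurability: the index set is countable and does not depend on `M`, and each
term is continuous in `M`. The sup norm replaces the last entry of a sorted family. -/
lemma minkowskiMin_eq_iInf (M : Matrix (Fin d) (Fin d) ℝ) (k : ℕ) (hk : k + 1 = d) :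
    minkowskiMin M (k + 1) =
      ⨅ u : {u : Fin (k + 1) → (Fin d → ℤ) // LinearIndependent ℤ u},
        ‖fun i => mnorm M (toR (u.1 i))‖ := by
  have hne : Nonempty {u : Fin (k + 1) → (Fin d → ℤ) // LinearIndependent ℤ u} := by
    subst hk
    exact ⟨⟨_, linearIndependent_stdBasis _⟩⟩
  apply le_antisymm
  · refine le_ciInf fun u => minkowskiMin_le u.2 fun i => ?_
    exact (le_abs_self _).trans (norm_le_pi_norm (fun i => mnorm M (toR (u.1 i))) i)
  · obtain ⟨u₀⟩ := hne
    refine le_csInf ⟨_, (exists_sorted M u₀.2).choose_spec⟩ ?_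
    rintro _ ⟨u, hu, hmono, rfl⟩
    refine (ciInf_le ⟨0, ?_⟩ ⟨u, hu⟩).trans ?_
    · rintro _ ⟨v, rfl⟩
      exact norm_nonneg _
    · refine (pi_norm_le_iff_of_nonneg (mnorm_nonneg _ _)).2 fun i => ?_
      rw [Real.norm_eq_abs, abs_of_nonneg (mnorm_nonneg _ _)]
      exact hmono (Fin.le_last i)

lemma minkowskiMin_le_top (M : Matrix (Fin d) (Fin d) ℝ) (i : Fin d) :
    minkowskiMin M ((i : ℕ) + 1) ≤ minkowskiMin M d := by
  obtain ⟨k, rfl⟩ : ∃ k, d = k + 1 := ⟨d - 1, by have := i.2; lia⟩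
  refine le_csInf ⟨_, (exists_sorted M (linearIndependent_stdBasis _)).choose_spec⟩ ?_
  rintro _ ⟨u, hu, hmono, rfl⟩
  -- An initial segment of a sorted free family is free, with norms below the last one.
  exact minkowskiMin_le (hu.comp (Fin.castLE i.2) (Fin.castLE_injective _))
    fun j => hmono (Fin.le_last _)

lemma IsReducedBasis.mnorm_le {M : Matrix (Fin d) (Fin d) ℝ} {u : Fin d → (Fin d → ℤ)}
    (hu : IsReducedBasis M u) (i : Fin d) : mnorm M (toR (u i)) ≤ minkowskiMin M d :=
  (hu.norm_eq i).trans_le (minkowskiMin_le_top M i)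

lemma IsSignedPerm.mnorm_le {M : Matrix (Fin d) (Fin d) ℝ} {u w : Fin d → (Fin d → ℤ)}
    (hM : M.PosDef) (hw : IsSignedPerm u w) {L : ℝ} (hu : ∀ i, mnorm M (toR (u i)) ≤ L)
    (i : Fin d) : mnorm M (toR (w i)) ≤ L := by
  obtain ⟨σ, ε, hε, h⟩ := hw
  have h1 := mnorm_sum_smul_le hM ((mnorm_nonneg _ _).trans (hu (σ i)))
    (w := fun _ : Fin 1 => u (σ i)) (fun _ => hu (σ i)) (c := fun _ => ε (σ i)) (K := 1)
    (by rcases hε (σ i) with h | h <;> simp [h])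
  simpa [h i] using h1

end MinkowskiMin

/-! ### Radii of the meshes. -/

section Meshes

lemma boundingRadius_le_of_hasSignVertices {d : ℕ} {M : Matrix (Fin d) (Fin d) ℝ} (hM : M.PosDef)
    {u : Fin d → (Fin d → ℤ)} (hu : IsReducedBasis M u) {T : Set (Set (Fin d → ℝ))}
    (hT : HasSignVertices u T) : boundingRadius M T ≤ d * minkowskiMin M d := by
  have hL := minkowskiMin_nonneg M d
  refine boundingRadius_le hM (by positivity) fun S hS v hv => ?_
  obtain ⟨ε, hε, rfl⟩ := hT S hS v hv
  refine mnorm_sum_smul_le hM hL hu.mnorm_le ?_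
  calc ∑ i, |ε i| ≤ ∑ _i : Fin d, (1 : ℤ) :=
        Finset.sum_le_sum fun i _ => by rcases hε i with h | h | h <;> simp [h]
    _ = d := by simp

/-- The vertices of a superbase mesh are the sums of subfamilies of the superbase. -/
lemma boundingRadius_superbaseMesh_le {d : ℕ} {M : Matrix (Fin d) (Fin d) ℝ} (hM : M.PosDef)
    {w : Fin d → (Fin d → ℤ)} {b : Fin (d + 1) → (Fin d → ℤ)} {L : ℝ} (hL : 0 ≤ L)
    (hw : ∀ i, mnorm M (toR (w i)) ≤ L) {K : ℕ} (B : Fin (d + 1) → Fin d → ℤ)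
    (hb : ∀ j, b j = ∑ i, B j i • w i)
    (hB : ∀ s : Finset (Fin (d + 1)), ∑ i, |∑ j ∈ s, B j i| ≤ K) :
    boundingRadius M (superbaseMesh b) ≤ K * L := by
  refine boundingRadius_le hM (by positivity) ?_
  rintro _ ⟨σ, rfl⟩ _ ⟨k, rfl⟩
  have : ∑ j ∈ Finset.Iio k, b (σ j) =
      ∑ i, (∑ j ∈ (Finset.Iio k).map σ.toEmbedding, B j i) • w i := by
    simp_rw [Finset.sum_smul]
    rw [Finset.sum_comm, Finset.sum_map]
    exact Finset.sum_congr rfl fun j _ => hb _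
  beta_reduce
  rw [this]
  exact mnorm_sum_smul_le hM hL hw (hB _)

lemma boundingRadius_constructedMesh₂_le {M : Matrix (Fin 2) (Fin 2) ℝ} (hM : M.PosDef)
    {T : Set (Set (Fin 2 → ℝ))} (hT : IsConstructedMesh₂ M T) :
    boundingRadius M T ≤ 2 * minkowskiMin M 2 := by
  obtain ⟨u, w, hu, hw, -, rfl⟩ := hT
  -- The rows are the coordinates of the `b_j` in `w`; `decide` checks all subsets of rows.
  refine boundingRadius_superbaseMesh_le hM (minkowskiMin_nonneg M 2)
    (hw.mnorm_le hM hu.mnorm_le) (K := 2) ![![1, 0], ![0, 1], ![-1, -1]] ?_ (by decide)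
  intro j
  fin_cases j <;> simp [Fin.sum_univ_two]
  abel

lemma boundingRadius_constructedMesh₃_le {M : Matrix (Fin 3) (Fin 3) ℝ} (hM : M.PosDef)
    {T : Set (Set (Fin 3 → ℝ))} (hT : IsConstructedMesh₃ M T) :
    boundingRadius M T ≤ 3 * minkowskiMin M 3 := by
  obtain ⟨u, w, b, hu, hw, hb, -, rfl⟩ := hT
  have hw' := hw.mnorm_le hM hu.mnorm_le
  rcases hb with rfl | rfl
  · refine boundingRadius_superbaseMesh_le hM (minkowskiMin_nonneg M 3) hw' (K := 3)
      ![![1, 0, 0], ![0, 1, 0], ![0, 0, 1], ![-1, -1, -1]] ?_ (by decide)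
    intro j
    fin_cases j <;> simp [Fin.sum_univ_three]
    abel
  · refine boundingRadius_superbaseMesh_le hM (minkowskiMin_nonneg M 3) hw' (K := 3)
      ![![1, -1, 0], ![0, 1, -1], ![0, 0, 1], ![-1, 0, 0]] ?_ (by decide)
    intro j
    fin_cases j <;> simp [Fin.sum_univ_three] <;> abel

lemma boundingRadius_mesh₄_le {M : Matrix (Fin 4) (Fin 4) ℝ} (hM : M.PosDef)
    {u : Fin 4 → (Fin 4 → ℤ)} (hu : IsReducedBasis M u) :
    boundingRadius M (mesh₄ u) ≤ 5 * minkowskiMin M 4 := by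
  have hL := minkowskiMin_nonneg M 4
  refine boundingRadius_le hM (by positivity) ?_
  rintro S ⟨v, hv, hS⟩ x hx
  -- Only six coefficient vectors occur among the vertices; `(2, 1, 1, 1)` gives the constant 5.
  have key : ∀ c : Fin 4 → ℤ, ∑ i, |c i| ≤ (5 : ℕ) →
      mnorm M (toR (c 0 • v 0 + c 1 • v 1 + c 2 • v 2 + c 3 • v 3)) ≤ 5 * minkowskiMin M 4 := by
    intro c hc
    have := mnorm_sum_smul_le hM hL (hv.mnorm_le hM hu.mnorm_le) hc
    rwa [Fin.sum_univ_four] at this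
  have h0 := key ![0, 0, 0, 0] (by decide)
  have h1 := key ![1, 0, 0, 0] (by decide)
  have h2 := key ![1, 1, 0, 0] (by decide)
  have h3 := key ![1, 1, 1, 0] (by decide)
  have h4 := key ![1, 1, 1, 1] (by decide)
  have h5 := key ![2, 1, 1, 1] (by decide)
  simp only [Matrix.cons_val, zero_smul, one_smul, add_zero] at h0 h1 h2 h3 h4 h5
  rcases hS with rfl | rfl <;> obtain ⟨z, hz, rfl⟩ := hx <;>
    simp only [Set.mem_insert_iff, Set.mem_singleton_iff] at hz <;>
    rcases hz with rfl | rfl | rfl | rfl | rfl <;> assumption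

end Meshes

/-! ### Geometry of numbers: a weak second theorem of Minkowski. -/

section GeometryOfNumbers

variable {d : ℕ}

/-- Minkowski's linear forms theorem. -/
theorem exists_int_ne_zero_forall_abs_mulVec_lt {Q : Matrix (Fin d) (Fin d) ℝ} (hQ : Q.det ≠ 0)
    {r : ℝ} (hr : 0 < r) (h : |Q.det| < r ^ d) :
    ∃ z : Fin d → ℤ, z ≠ 0 ∧ ∀ i, |(Q *ᵥ toR z) i| < r := by
  let b := Pi.basisFun ℝ (Fin d)
  have hdet : LinearMap.det (toLin' Q) ≠ 0 := by rwa [LinearMap.det_toLin']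
  have fund := ZSpan.isAddFundamentalDomain' b (volume : Measure (Fin d → ℝ))
  have : Countable (Submodule.span ℤ (Set.range b)).toAddSubgroup :=
    inferInstanceAs (Countable (Submodule.span ℤ (Set.range b)))
  have hvol : volume (ZSpan.fundamentalDomain b) = 1 := by
    rw [ZSpan.fundamentalDomain_pi_basisFun, Real.volume_pi_Ico]
    simp
  -- The symmetric convex body `‖Qx‖ < r` (sup norm) has volume `(2r)^d / |det Q|`, which exceeds
  -- `2^d`.
  obtain ⟨⟨x, hx⟩, hx0, hxs⟩ := exists_ne_zero_mem_lattice_of_measure_mul_two_pow_lt_measure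
    (s := toLin' Q ⁻¹' Metric.ball 0 r) fund
    (fun x hx => by simpa [mulVec_neg] using hx) ((convex_ball 0 r).linear_preimage _) (by
      rw [Measure.addHaar_preimage_linearMap _ hdet, Real.volume_pi_ball _ hr, hvol, one_mul,
        ← ENNReal.ofReal_mul (abs_nonneg _), LinearMap.det_toLin', Module.finrank_fin_fun,
        Fintype.card_fin, abs_inv, mul_pow]
      have h2 : (2 : ENNReal) ^ d = ENNReal.ofReal (2 ^ d) := by
        rw [ENNReal.ofReal_pow (by norm_num)]
        simp
      rw [h2]
      refine (ENNReal.ofReal_lt_ofReal_iff_of_nonneg (by positivity)).2 ?_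
      rw [← div_eq_inv_mul, lt_div_iff₀ (abs_pos.2 hQ)]
      exact mul_lt_mul_of_pos_left h (by positivity))
  have hint : ∀ i, ∃ n : ℤ, (n : ℝ) = x i := by
    intro i
    obtain ⟨n, hn⟩ := (b.mem_span_iff_repr_mem ℤ x).1 hx i
    exact ⟨n, by simpa [b] using hn⟩
  choose z hz using hint
  have hzx : toR z = x := funext hz
  refine ⟨z, ?_, fun i => ?_⟩
  · rintro rfl
    refine hx0 (Subtype.ext (hzx.symm.trans ?_))
    ext i
    simp [toR]
  · have hb : ‖Q *ᵥ x‖ < r := by simpa using hxs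
    rw [hzx]
    exact (norm_le_pi_norm (Q *ᵥ x) i).trans_lt hb

/-- A set of lattice vectors without a free family of full size lies in a hyperplane. -/
lemma exists_linearMap_eq_zero_of_forall_not_linearIndependent {P : Set (Fin d → ℤ)}
    (hP : ∀ u : Fin d → (Fin d → ℤ), LinearIndependent ℤ u → ∃ i, u i ∉ P) :
    ∃ φ : (Fin d → ℝ) →ₗ[ℝ] ℝ, φ ≠ 0 ∧ ∀ z ∈ P, φ (toR z) = 0 := by
  have hlt : Submodule.span ℝ (toR '' P) < ⊤ := by
    rw [lt_top_iff_ne_top]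
    intro htop
    -- If `P` spanned the whole space, it would contain a real basis, which is also free over `ℤ`.
    obtain ⟨s, hs, hspan, hli⟩ := exists_linearIndependent ℝ (toR '' P)
    let B : Module.Basis s ℝ (Fin d → ℝ) := Module.Basis.mk hli (by
      rw [Subtype.range_coe, hspan, htop])
    have : Fintype s := FiniteDimensional.fintypeBasisIndex B
    have hcard : Fintype.card s = d := by
      rw [← Module.finrank_eq_card_basis B, Module.finrank_fin_fun]
    let e : Fin d ≃ s := (Fintype.equivFinOfCardEq hcard).symm
    choose v hvP hv using fun i => hs (e i).2
    have hlin : LinearIndependent ℝ (fun i => toR (v i)) := by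
      have heq : (fun i => toR (v i)) = Subtype.val ∘ e := funext hv
      rw [heq]
      exact hli.comp e e.injective
    have hlinZ : LinearIndependent ℤ v := by
      refine LinearIndependent.of_comp (toRLin d) ?_
      refine hlin.restrict_scalars (R := ℤ) ?_
      intro m n hmn
      simpa using hmn
    obtain ⟨i, hi⟩ := hP v hlinZ
    exact hi (hvP i)
  obtain ⟨φ, hφ, hle⟩ := Submodule.exists_le_ker_of_lt_top _ hlt
  exact ⟨φ, hφ, fun z hz => hle (Submodule.subset_span ⟨z, hz, rfl⟩)⟩

lemma exists_unit_normal {Q : Matrix (Fin d) (Fin d) ℝ} (hQ : Q.det ≠ 0)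
    {P : Set (Fin d → ℤ)}
    (hP : ∀ u : Fin d → (Fin d → ℤ), LinearIndependent ℤ u → ∃ i, u i ∉ P) :
    ∃ ν : Fin d → ℝ, ν ⬝ᵥ ν = 1 ∧ ∀ z ∈ P, ν ⬝ᵥ (Q *ᵥ toR z) = 0 := by
  obtain ⟨φ, hφ, hφP⟩ := exists_linearMap_eq_zero_of_forall_not_linearIndependent hP
  have hinv : Q⁻¹ * Q = 1 := nonsing_inv_mul _ (isUnit_iff_ne_zero.2 hQ)
  -- `μ` represents the functional `φ ∘ Q⁻¹`; normalising it gives the normal of the hyperplane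
  -- containing `Q P`.
  let μ : Fin d → ℝ := fun i => φ (Q⁻¹ *ᵥ fun j => if i = j then 1 else 0)
  have hμ : ∀ x, μ ⬝ᵥ (Q *ᵥ x) = φ x := by
    intro x
    have := LinearMap.pi_apply_eq_sum_univ (φ ∘ₗ toLin' Q⁻¹) (Q *ᵥ x)
    simp only [LinearMap.comp_apply, toLin'_apply, mulVec_mulVec, hinv, one_mulVec,
      smul_eq_mul] at this
    rw [this, dotProduct_comm]
    rfl
  have hμ0 : 0 < μ ⬝ᵥ μ := by
    have h0 : μ ≠ 0 := by
      intro h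
      refine hφ (LinearMap.ext fun x => ?_)
      rw [← hμ, h]
      simp
    have := dotProduct_self_star_pos_iff.2 h0
    simpa using this
  refine ⟨(√(μ ⬝ᵥ μ))⁻¹ • μ, ?_, fun z hz => ?_⟩
  · rw [smul_dotProduct, dotProduct_smul, smul_eq_mul, smul_eq_mul, ← mul_assoc, ← mul_inv,
      Real.mul_self_sqrt hμ0.le, inv_mul_cancel₀ hμ0.ne']
  · rw [smul_dotProduct, hμ, hφP z hz, smul_zero]

/-- The last minimum is bounded in terms of the first one and of the determinant: a weak form of
Minkowski's second theorem. -/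
theorem minkowskiMin_le_of_forall_le {k : ℕ} {Q N : Matrix (Fin (k + 1)) (Fin (k + 1)) ℝ}
    (hQ : |Q.det| = 1) {A : ℝ} (hA : 0 ≤ A)
    (hN : ∀ x, mnorm N x = A * √((Q *ᵥ x) ⬝ᵥ (Q *ᵥ x))) {a : ℝ} (ha : 0 < a)
    (h : ∀ z : Fin (k + 1) → ℤ, z ≠ 0 → a ^ 2 ≤ (Q *ᵥ toR z) ⬝ᵥ (Q *ᵥ toR z)) :
    minkowskiMin N (k + 1) ≤ A * (2 * (2 * (k + 1)) ^ (k + 1) / a ^ k) := by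
  have hQ0 : Q.det ≠ 0 := fun h0 => by simp [h0] at hQ
  set L : ℝ := 2 * (2 * (k + 1)) ^ (k + 1) / a ^ k with hLdef
  have hL : 0 < L := by positivity
  by_contra hcon
  -- If the bound fails, the lattice vectors shorter than `L` contain no free family of full size,
  -- so they lie in the hyperplane orthogonal to `ν`.
  obtain ⟨ν, hν, hνP⟩ := exists_unit_normal hQ0 (P := {z | (Q *ᵥ toR z) ⬝ᵥ (Q *ᵥ toR z) < L ^ 2}) (by
    intro u hu
    by_contra! hall
    refine hcon (minkowskiMin_le hu fun i => ?_)
    rw [hN]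
    refine mul_le_mul_of_nonneg_left ?_ hA
    exact Real.sqrt_le_iff.2 ⟨hL.le, (hall i).le⟩)
  -- `T` fixes that hyperplane and multiplies `ν` by `a / L`.
  let T : Matrix (Fin (k + 1)) (Fin (k + 1)) ℝ :=
    1 + replicateCol Unit ((a / L - 1) • ν) * replicateRow Unit ν
  have hTdet : T.det = a / L := by
    rw [det_one_add_replicateCol_mul_replicateRow, dotProduct_smul, hν]
    simp
  have hT : ∀ y, T *ᵥ y = y + (ν ⬝ᵥ y) • ((a / L - 1) • ν) := by
    intro y
    rw [add_mulVec, one_mulVec, ← vecMulVec_eq, vecMulVec_mulVec]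
    ext i
    simp [mul_comm]
  have hTsq : ∀ y, (T *ᵥ y) ⬝ᵥ (T *ᵥ y) =
      (y ⬝ᵥ y - (ν ⬝ᵥ y) ^ 2) + (a / L) ^ 2 * (ν ⬝ᵥ y) ^ 2 := by
    intro y
    rw [hT]
    simp only [add_dotProduct, dotProduct_add, smul_dotProduct, dotProduct_smul, hν, smul_eq_mul,
      dotProduct_comm y ν]
    ring
  -- With this `r`, the choice of `L` makes `det T = a / L` equal to `r^(k+1) / 2`, and sup norm
  -- below `r` forces Euclidean length at most `a / 2`.
  have hr : 0 < a / (2 * (k + 1)) := by positivity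
  obtain ⟨z, hz0, hz⟩ := exists_int_ne_zero_forall_abs_mulVec_lt (Q := T * Q)
    (by rw [det_mul, hTdet]; positivity) hr (by
      rw [det_mul, hTdet, abs_mul, hQ, abs_of_pos (by positivity), hLdef, mul_one]
      rw [div_pow, div_div_eq_mul_div, ← pow_succ']
      refine div_lt_div_of_pos_left (by positivity) (by positivity) ?_
      have : (0 : ℝ) < (2 * (k + 1)) ^ (k + 1) := by positivity
      linarith)
  have hz' : (T *ᵥ (Q *ᵥ toR z)) ⬝ᵥ (T *ᵥ (Q *ᵥ toR z)) ≤ a ^ 2 / 4 := by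
    rw [mulVec_mulVec]
    calc ((T * Q) *ᵥ toR z) ⬝ᵥ ((T * Q) *ᵥ toR z)
        ≤ ∑ _i : Fin (k + 1), (a / (2 * (k + 1))) ^ 2 := by
          refine Finset.sum_le_sum fun i _ => ?_
          rw [← sq, sq_le_sq, abs_of_pos hr]
          exact (hz i).le
      _ = a ^ 2 / 4 * (1 / (k + 1)) := by
          rw [Finset.sum_const, Finset.card_univ, Fintype.card_fin, nsmul_eq_mul]
          push_cast
          field_simp
          norm_num
      _ ≤ a ^ 2 / 4 * 1 := by
          refine mul_le_mul_of_nonneg_left ?_ (by positivity)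
          rw [div_le_one (by positivity)]
          have : (0 : ℝ) ≤ k := by positivity
          linarith
      _ = a ^ 2 / 4 := mul_one _
  have hza := h z hz0
  have ha2 : 0 < a ^ 2 := by positivity
  set y := Q *ᵥ toR z with hy
  rw [hTsq] at hz'
  have hbessel : 0 ≤ y ⬝ᵥ y - (ν ⬝ᵥ y) ^ 2 := by
    have h0 : 0 ≤ (y - (ν ⬝ᵥ y) • ν) ⬝ᵥ (y - (ν ⬝ᵥ y) • ν) :=
      Finset.sum_nonneg fun i _ => mul_self_nonneg _
    simp only [sub_dotProduct, dotProduct_sub, smul_dotProduct, dotProduct_smul, hν, smul_eq_mul,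
      dotProduct_comm y ν] at h0
    linarith
  have hs := sq_nonneg (ν ⬝ᵥ y)
  -- If `L ≤ a`, then `T` does not shorten `y`, against `|y| ≥ a`. Otherwise `|y| ≤ L / 2`, so `y`
  -- lies in the hyperplane and `T` fixes it: `|y| ≤ a / 2`, again impossible.
  rcases le_or_gt L a with hLa | hLa
  · have : 1 ≤ (a / L) ^ 2 := one_le_pow₀ ((one_le_div hL).2 hLa)
    nlinarith
  · have hlt : (a / L) ^ 2 ≤ 1 := pow_le_one₀ (by positivity) ((div_le_one hL).2 hLa.le)
    have h1 : (a / L) ^ 2 * (y ⬝ᵥ y) ≤ a ^ 2 / 4 := by nlinarith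
    have h2 : y ⬝ᵥ y < L ^ 2 := by
      rw [div_pow, div_mul_eq_mul_div, div_le_iff₀ (by positivity)] at h1
      have h3 : y ⬝ᵥ y ≤ L ^ 2 / 4 := by
        refine le_of_mul_le_mul_left ?_ ha2
        linarith
      have : 0 < L ^ 2 := by positivity
      linarith
    rw [hνP z h2] at hz'
    linarith

end GeometryOfNumbers

/-! ### Averages over the orthogonal group. -/

section Orthogonal

variable {d : ℕ}

/-- The orthogonal group acts transitively on spheres. -/
lemma exists_orthogonal_mulVec_eq {x y : Fin d → ℝ} (h : x ⬝ᵥ x = y ⬝ᵥ y) :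
    ∃ R : orthogonalGroup (Fin d) ℝ, (R : Matrix (Fin d) (Fin d) ℝ) *ᵥ x = y := by
  rcases eq_or_ne x y with rfl | hxy
  · exact ⟨1, by simp⟩
  set v := x - y with hv
  have hc : v ⬝ᵥ v ≠ 0 := fun h0 => sub_ne_zero.2 hxy (dotProduct_self_eq_zero.1 h0)
  set c := v ⬝ᵥ v with hcdef
  have hvx : c = 2 * (v ⬝ᵥ x) := by
    simp only [hcdef, hv, sub_dotProduct, dotProduct_sub, dotProduct_comm x y]
    linarith
  -- `1 - V` is the reflection exchanging `x` and `y`.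
  let V : Matrix (Fin d) (Fin d) ℝ := (2 / c) • vecMulVec v v
  have hVV : V * V = (2 : ℝ) • V := by
    simp only [V, Matrix.smul_mul, Matrix.mul_smul, vecMulVec_mul_vecMulVec, ← hcdef, smul_smul, vecMulVec_smul]
    congr 1
    field_simp
  have hVt : Vᵀ = V := by simp only [V, transpose_smul, transpose_vecMulVec]
  refine ⟨⟨1 - V, ?_⟩, ?_⟩
  · rw [mem_unitaryGroup_iff, star_eq_conjTranspose, conjTranspose_eq_transpose_of_trivial,
      transpose_sub, transpose_one, hVt, mul_sub, sub_mul, sub_mul, hVV, two_smul]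
    simp
  · change (1 - V) *ᵥ x = y
    have hVx : V *ᵥ x = v := by
      simp only [V, smul_mulVec, vecMulVec_mulVec]
      ext i
      simp only [Pi.smul_apply, smul_eq_mul, op_smul_eq_smul]
      have : v ⬝ᵥ x = c / 2 := by linarith
      rw [this]
      field_simp
    rw [sub_mulVec, one_mulVec, hVx, hv]
    abel

lemma abs_det_orthogonal (R : orthogonalGroup (Fin d) ℝ) :
    |(R : Matrix (Fin d) (Fin d) ℝ).det| = 1 := by
  have h := congrArg det (mem_unitaryGroup_iff.1 R.2)
  rw [det_mul, star_eq_conjTranspose, conjTranspose_eq_transpose_of_trivial, det_transpose,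
    det_one, ← abs_mul_abs_self] at h
  nlinarith [abs_nonneg (R : Matrix (Fin d) (Fin d) ℝ).det]

lemma continuous_orthogonal_mulVec :
    Continuous fun p : orthogonalGroup (Fin d) ℝ × (Fin d → ℝ) =>
      (p.1 : Matrix (Fin d) (Fin d) ℝ) *ᵥ p.2 :=
  (continuous_subtype_val.comp continuous_fst).matrix_mulVec continuous_snd

/-- A compact group is unimodular: a right translate of the Haar probability measure is again one,
hence the same. -/
lemma lintegral_orthogonal_mul_right (f : orthogonalGroup (Fin d) ℝ → ENNReal)
    (R₀ : orthogonalGroup (Fin d) ℝ) :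
    ∫⁻ R, f (R * R₀) ∂orthogonalHaar d = ∫⁻ R, f R ∂orthogonalHaar d := by
  have : IsProbabilityMeasure ((orthogonalHaar d).map (· * R₀)) :=
    Measure.isProbabilityMeasure_map (measurable_mul_const R₀).aemeasurable
  have hmap : (orthogonalHaar d).map (· * R₀) = orthogonalHaar d :=
    Measure.isHaarMeasure_eq_of_isProbabilityMeasure _ _
  conv_rhs => rw [← hmap]
  exact (lintegral_map_equiv f (MeasurableEquiv.mulRight R₀)).symm

lemma lintegral_comp_mulVec {Q : Matrix (Fin d) (Fin d) ℝ} (hQ : Q.det ≠ 0)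
    {F : (Fin d → ℝ) → ENNReal} (hF : Measurable F) :
    ∫⁻ x, F (Q *ᵥ x) = ENNReal.ofReal |Q.det⁻¹| * ∫⁻ x, F x := by
  have hmap := Real.map_matrix_volume_pi_eq_smul_volume_pi hQ
  have hmeas : Measurable (toLin' Q) := (LinearMap.continuous_of_finiteDimensional _).measurable
  rw [← smul_eq_mul, ← lintegral_smul_measure, ← hmap, lintegral_map hF hmeas]
  rfl

/-- The mean of a radially decreasing function over the rotations of a vector decreases with the
length of the vector. -/
lemma lintegral_orthogonal_le_of_dotProduct_le {F : (Fin d → ℝ) → ENNReal}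
    (hmono : ∀ x, ∀ t : ℝ, 0 ≤ t → t ≤ 1 → F x ≤ F (t • x)) {x y : Fin d → ℝ}
    (hx : 0 < x ⬝ᵥ x) (hyx : y ⬝ᵥ y ≤ x ⬝ᵥ x) :
    ∫⁻ R : orthogonalGroup (Fin d) ℝ, F ((R : Matrix (Fin d) (Fin d) ℝ) *ᵥ x) ∂orthogonalHaar d ≤
      ∫⁻ R : orthogonalGroup (Fin d) ℝ, F ((R : Matrix (Fin d) (Fin d) ℝ) *ᵥ y)
        ∂orthogonalHaar d := by
  have hy : 0 ≤ y ⬝ᵥ y := Finset.sum_nonneg fun i _ => mul_self_nonneg _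
  set t := √((y ⬝ᵥ y) / (x ⬝ᵥ x)) with ht
  have htt : t * t = (y ⬝ᵥ y) / (x ⬝ᵥ x) := Real.mul_self_sqrt (by positivity)
  obtain ⟨R₀, hR₀⟩ := exists_orthogonal_mulVec_eq (x := t • x) (y := y) (by
    rw [smul_dotProduct, dotProduct_smul, smul_eq_mul, smul_eq_mul, ← mul_assoc, htt]
    field_simp)
  rw [← lintegral_orthogonal_mul_right _ R₀]
  refine lintegral_mono fun R => ?_
  refine (hmono _ t (Real.sqrt_nonneg _)
    (Real.sqrt_le_one.2 ((div_le_one hx).2 hyx))).trans_eq ?_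
  rw [← hR₀, mulVec_mulVec, ← mulVec_smul]
  rfl

/-- Coordinatewise `y_i² ≤ 3 z_i² + 1`, and `|z| ≥ 1`, so the factor `1 / (d + 1)` brings the whole
cube inside the ball of radius `|z|`. -/
lemma dotProduct_le_of_mem_cube {z : Fin d → ℤ} (hz : z ≠ 0) {y : Fin d → ℝ}
    (hy : ∀ i, y i ∈ Set.Ico (z i : ℝ) (z i + 1)) :
    0 < toR z ⬝ᵥ toR z ∧
      (((d : ℝ) + 1)⁻¹ • y) ⬝ᵥ (((d : ℝ) + 1)⁻¹ • y) ≤ toR z ⬝ᵥ toR z := by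
  obtain ⟨j, hj⟩ := Function.ne_iff.1 hz
  have hd : (1 : ℝ) ≤ d := by exact_mod_cast Fin.pos j
  have hone : (1 : ℝ) ≤ toR z ⬝ᵥ toR z := by
    have h1 : (1 : ℝ) ≤ toR z j * toR z j := by
      have : (1 : ℤ) ≤ z j * z j := by
        have : 0 < z j * z j := mul_self_pos.2 hj
        lia
      simp only [toR]
      exact_mod_cast this
    exact h1.trans (Finset.single_le_sum (f := fun i => toR z i * toR z i)
      (fun i _ => mul_self_nonneg _) (Finset.mem_univ j))
  refine ⟨by linarith, ?_⟩
  have hsum : y ⬝ᵥ y ≤ 3 * (toR z ⬝ᵥ toR z) + d := by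
    have : ∀ i, y i * y i ≤ 3 * (toR z i * toR z i) + 1 := by
      intro i
      obtain ⟨h1, h2⟩ := hy i
      have h3 : (z i : ℝ) ≤ z i * z i := by
        have := Int.le_self_sq (z i)
        rw [sq] at this
        exact_mod_cast this
      have h4 : -(z i : ℝ) ≤ z i * z i := by
        have := Int.le_self_sq (-z i)
        rw [sq, neg_mul_neg] at this
        exact_mod_cast this
      simp only [toR]
      nlinarith [mul_self_nonneg (z i : ℝ)]
    calc y ⬝ᵥ y ≤ ∑ i, (3 * (toR z i * toR z i) + 1) := Finset.sum_le_sum fun i _ => this i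
      _ = 3 * (toR z ⬝ᵥ toR z) + d := by
        rw [Finset.sum_add_distrib, ← Finset.mul_sum]
        simp [dotProduct]
  rw [smul_dotProduct, dotProduct_smul, smul_eq_mul, smul_eq_mul, ← mul_assoc, ← mul_inv,
    inv_mul_le_iff₀ (by positivity)]
  have hd2 : (0 : ℝ) ≤ d * d + 2 * d - 2 := by nlinarith
  nlinarith [mul_nonneg hd2 (sub_nonneg.2 hone)]

/-- A form of Siegel's mean value theorem for the rotations of the lattice `ℤᵈ` and radially
decreasing functions. -/
theorem tsum_lintegral_orthogonal_le {F : (Fin d → ℝ) → ENNReal} (hF : Measurable F)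
    (hmono : ∀ x, ∀ t : ℝ, 0 ≤ t → t ≤ 1 → F x ≤ F (t • x)) :
    ∑' z : {z : Fin d → ℤ // z ≠ 0},
        ∫⁻ R : orthogonalGroup (Fin d) ℝ, F ((R : Matrix (Fin d) (Fin d) ℝ) *ᵥ toR z.1)
          ∂orthogonalHaar d ≤
      ENNReal.ofReal (((d : ℝ) + 1) ^ d) * ∫⁻ x, F x := by
  set c : ℝ := ((d : ℝ) + 1)⁻¹ with hc
  have hc0 : 0 < c := by positivity
  let cube : {z : Fin d → ℤ // z ≠ 0} → Set (Fin d → ℝ) := fun z =>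
    Set.univ.pi fun i => Set.Ico (z.1 i : ℝ) (z.1 i + 1)
  let G : (Fin d → ℝ) → ENNReal := fun y =>
    ∫⁻ R : orthogonalGroup (Fin d) ℝ, F ((R : Matrix (Fin d) (Fin d) ℝ) *ᵥ (c • y))
      ∂orthogonalHaar d
  have hmeas : ∀ z, MeasurableSet (cube z) := fun z =>
    MeasurableSet.univ_pi fun i => measurableSet_Ico
  have hvol : ∀ z, volume (cube z) = 1 := by
    intro z
    simp only [cube]
    rw [Real.volume_pi_Ico]
    simp
  have hdisj : Pairwise (Function.onFun Disjoint cube) := by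
    intro z w hzw
    refine Set.disjoint_left.2 fun y hyz hyw => hzw (Subtype.ext (funext fun i => ?_))
    rw [← Int.floor_eq_iff.2 (hyz i trivial), ← Int.floor_eq_iff.2 (hyw i trivial)]
  have huncurry : Measurable fun p : (Fin d → ℝ) × orthogonalGroup (Fin d) ℝ =>
      F ((p.2 : Matrix (Fin d) (Fin d) ℝ) *ᵥ (c • p.1)) := by
    refine hF.comp (Continuous.measurable ?_)
    exact continuous_orthogonal_mulVec.comp
      (continuous_snd.prodMk (continuous_fst.const_smul c))
  -- Each term is at most the integral of `G` over the unit cube at `z`. These cubes are disjoint,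
  -- and undoing the scaling by `c` costs `(d + 1)^d`.
  calc _ ≤ ∑' z, ∫⁻ y in cube z, G y := by
        refine ENNReal.tsum_le_tsum fun z => ?_
        rw [← mul_one (lintegral _ _), ← hvol z, ← setLIntegral_const]
        refine setLIntegral_mono' (hmeas z) fun y hy => ?_
        obtain ⟨h1, h2⟩ := dotProduct_le_of_mem_cube z.2 fun i => hy i trivial
        exact lintegral_orthogonal_le_of_dotProduct_le hmono h1 h2
    _ = ∫⁻ y in ⋃ z, cube z, G y := (lintegral_iUnion hmeas hdisj G).symm
    _ ≤ ∫⁻ y, G y := setLIntegral_le_lintegral _ _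
    _ = ∫⁻ R : orthogonalGroup (Fin d) ℝ, (∫⁻ y, F ((R : Matrix (Fin d) (Fin d) ℝ) *ᵥ (c • y)))
          ∂orthogonalHaar d := lintegral_lintegral_swap huncurry.aemeasurable
    _ = ∫⁻ _R : orthogonalGroup (Fin d) ℝ, (ENNReal.ofReal (((d : ℝ) + 1) ^ d) * ∫⁻ x, F x)
          ∂orthogonalHaar d := by
        refine lintegral_congr fun R => ?_
        have hdet : |(c • (R : Matrix (Fin d) (Fin d) ℝ)).det| = c ^ d := by
          rw [det_smul, abs_mul, abs_det_orthogonal, mul_one, Fintype.card_fin,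
            abs_of_pos (by positivity)]
        have hdet0 : (c • (R : Matrix (Fin d) (Fin d) ℝ)).det ≠ 0 := by
          rw [← abs_pos, hdet]
          positivity
        have := lintegral_comp_mulVec hdet0 hF
        rw [abs_inv, hdet, hc, inv_pow, inv_inv] at this
        rw [← this]
        refine lintegral_congr fun y => ?_
        rw [smul_mulVec, mulVec_smul]
    _ = _ := by simp

end Orthogonal

/-! ### The mean of the last minimum. -/

section Average

variable {k : ℕ}

/-- The function `‖y‖^{-k}` on the unit ball of the sup norm of `ℝᵏ⁺¹`, extended by zero. -/
noncomputable def truncInvPow (k : ℕ) (y : Fin (k + 1) → ℝ) : ENNReal :=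
  if ‖y‖ ≤ 1 then (ENNReal.ofReal (‖y‖ ^ k))⁻¹ else 0

lemma measurable_truncInvPow (k : ℕ) : Measurable (truncInvPow k) := by
  refine Measurable.ite (measurableSet_le measurable_norm measurable_const) ?_ measurable_const
  exact ((measurable_norm.pow_const k).ennreal_ofReal).inv

/-- The case `t = 0` is no exception: the value at the origin is `⊤` for `k > 0` and 1 for `k = 0`.
-/
lemma truncInvPow_le_smul (x : Fin (k + 1) → ℝ) {t : ℝ} (h0 : 0 ≤ t) (h1 : t ≤ 1) :
    truncInvPow k x ≤ truncInvPow k (t • x) := by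
  have hn : ‖t • x‖ ≤ ‖x‖ := by
    rw [norm_smul, Real.norm_of_nonneg h0]
    exact mul_le_of_le_one_left (norm_nonneg _) h1
  unfold truncInvPow
  split_ifs with hx htx
  · exact ENNReal.inv_le_inv.2 (ENNReal.ofReal_le_ofReal (pow_le_pow_left₀ (norm_nonneg _) hn k))
  · exact absurd (hn.trans hx) htx
  · exact zero_le
  · exact le_rfl

lemma lintegral_truncInvPow_lt_top (k : ℕ) : ∫⁻ y, truncInvPow k y < ⊤ := by
  let f : ℝ → ℝ := fun r => if r ≤ 1 then (r ^ k)⁻¹ else 0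
  have hf : Integrable (fun y : Fin (k + 1) → ℝ => f ‖y‖) := by
    -- In polar coordinates the weight `r^k` cancels the singularity.
    rw [integrable_fun_norm_addHaar, Module.finrank_fin_fun, Nat.add_sub_cancel]
    have h1 : IntegrableOn ((Set.Iic (1 : ℝ)).indicator fun _ => (1 : ℝ)) (Set.Ioi 0) := by
      rw [IntegrableOn, integrable_indicator_iff measurableSet_Iic, IntegrableOn,
        Measure.restrict_restrict measurableSet_Iic, Set.inter_comm, Set.Ioi_inter_Iic]
      exact integrableOn_const (by simp)
    refine h1.congr_fun (fun r hr => ?_) measurableSet_Ioi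
    have hr0 : r ^ k ≠ 0 := pow_ne_zero _ (ne_of_gt hr)
    by_cases h : r ≤ 1 <;> simp [f, h, hr0]
  refine lt_of_eq_of_lt (lintegral_congr_ae ?_) hf.lintegral_lt_top
  -- The origin is excluded because the real and the extended inverse of 0 differ.
  filter_upwards [compl_mem_ae_iff.2 (measure_singleton (0 : Fin (k + 1) → ℝ))] with y hy
  have hy0 : 0 < ‖y‖ := norm_pos_iff.2 hy
  by_cases h : ‖y‖ ≤ 1
  · simp only [truncInvPow, f, h, if_true]
    rw [ENNReal.ofReal_inv_of_pos (by positivity)]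
  · simp [truncInvPow, f, h]

lemma norm_sq_le_dotProduct_self {d : ℕ} (y : Fin d → ℝ) : ‖y‖ ^ 2 ≤ y ⬝ᵥ y := by
  have h0 : 0 ≤ y ⬝ᵥ y := Finset.sum_nonneg fun i _ => mul_self_nonneg _
  have h : ‖y‖ ≤ √(y ⬝ᵥ y) := by
    refine (pi_norm_le_iff_of_nonneg (Real.sqrt_nonneg _)).2 fun i => ?_
    refine Real.abs_le_sqrt ?_
    rw [sq]
    exact Finset.single_le_sum (f := fun i => y i * y i) (fun i _ => mul_self_nonneg _)
      (Finset.mem_univ i)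
  calc ‖y‖ ^ 2 ≤ √(y ⬝ᵥ y) ^ 2 := pow_le_pow_left₀ (norm_nonneg _) h 2
    _ = y ⬝ᵥ y := Real.sq_sqrt h0

/-- The image of the lattice by an invertible matrix has a shortest nonzero vector. -/
lemma exists_norm_mulVec_le {Q : Matrix (Fin (k + 1)) (Fin (k + 1)) ℝ} (hQ : Q.det ≠ 0) :
    ∃ z₀ : Fin (k + 1) → ℤ, z₀ ≠ 0 ∧ 0 < ‖Q *ᵥ toR z₀‖ ∧
      ∀ z : Fin (k + 1) → ℤ, z ≠ 0 → ‖Q *ᵥ toR z₀‖ ≤ ‖Q *ᵥ toR z‖ := by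
  have hinv : Q⁻¹ * Q = 1 := nonsing_inv_mul _ (isUnit_iff_ne_zero.2 hQ)
  have hback : ∀ x, Q⁻¹ *ᵥ (Q *ᵥ x) = x := fun x => by rw [mulVec_mulVec, hinv, one_mulVec]
  let g := LinearMap.toContinuousLinearMap (toLin' Q⁻¹)
  let e : Fin (k + 1) → ℤ := fun _ => 1
  have he : e ≠ 0 := fun h => one_ne_zero (congrFun h 0)
  set C : ℝ := ‖g‖ * ‖Q *ᵥ toR e‖
  have hfin : {z : Fin (k + 1) → ℤ | z ≠ 0 ∧ ‖Q *ᵥ toR z‖ ≤ ‖Q *ᵥ toR e‖}.Finite := by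
    refine (Set.finite_Icc (fun _ : Fin (k + 1) => -⌈C⌉) (fun _ => ⌈C⌉)).subset ?_
    rintro z ⟨-, hz⟩
    have hn : ‖toR z‖ ≤ C := by
      calc ‖toR z‖ = ‖g (Q *ᵥ toR z)‖ := by
            rw [show g (Q *ᵥ toR z) = toR z from hback _]
        _ ≤ ‖g‖ * ‖Q *ᵥ toR z‖ := g.le_opNorm _
        _ ≤ C := mul_le_mul_of_nonneg_left hz (norm_nonneg _)
    have hi : ∀ i, |(z i : ℝ)| ≤ (⌈C⌉ : ℤ) := fun i =>
      ((norm_le_pi_norm (toR z) i).trans hn).trans (Int.le_ceil C)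
    have hi' : ∀ i, |z i| ≤ ⌈C⌉ := fun i => by exact_mod_cast hi i
    exact ⟨fun i => (abs_le.1 (hi' i)).1, fun i => (abs_le.1 (hi' i)).2⟩
  obtain ⟨z₀, ⟨hz₀, hz₀e⟩, hmin⟩ :=
    Set.exists_min_image _ (fun z => ‖Q *ᵥ toR z‖) hfin ⟨e, he, le_rfl⟩
  refine ⟨z₀, hz₀, norm_pos_iff.2 fun h => hz₀ ?_, fun z hz => ?_⟩
  · have := hback (toR z₀)
    rw [h, mulVec_zero] at this
    refine toR_injective (this.symm.trans ?_)
    ext i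
    simp [toR]
  · by_cases h : ‖Q *ᵥ toR z‖ ≤ ‖Q *ᵥ toR e‖
    · exact hmin z ⟨hz, h⟩
    · exact hz₀e.trans (not_le.1 h).le

/-- The last minimum is bounded by a sum over the lattice. -/
lemma ofReal_minkowskiMin_le_tsum {Q N : Matrix (Fin (k + 1)) (Fin (k + 1)) ℝ}
    (hQ : |Q.det| = 1) {A : ℝ} (hA : 0 ≤ A)
    (hN : ∀ x, mnorm N x = A * √((Q *ᵥ x) ⬝ᵥ (Q *ᵥ x))) :
    ENNReal.ofReal (minkowskiMin N (k + 1)) ≤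
      ENNReal.ofReal (A * (2 * (2 * (k + 1)) ^ (k + 1))) *
        (1 + ∑' z : {z : Fin (k + 1) → ℤ // z ≠ 0}, truncInvPow k (Q *ᵥ toR z.1)) := by
  have hQ0 : Q.det ≠ 0 := fun h0 => by simp [h0] at hQ
  obtain ⟨z₀, hz₀, hpos, hmin⟩ := exists_norm_mulVec_le hQ0
  have hsq : ∀ a : ℝ, 0 ≤ a → a ≤ ‖Q *ᵥ toR z₀‖ → ∀ z : Fin (k + 1) → ℤ, z ≠ 0 →
      a ^ 2 ≤ (Q *ᵥ toR z) ⬝ᵥ (Q *ᵥ toR z) := fun a ha haz z hz =>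
    (pow_le_pow_left₀ ha (haz.trans (hmin z hz)) 2).trans (norm_sq_le_dotProduct_self _)
  -- A shortest vector of sup norm at least 1 allows `a = 1`, paid for by the summand 1; otherwise
  -- `a^(-k)` is the term of the sum at `z₀`.
  rcases le_or_gt 1 ‖Q *ᵥ toR z₀‖ with h1 | h1
  · have := minkowskiMin_le_of_forall_le hQ hA hN one_pos (hsq 1 zero_le_one h1)
    rw [one_pow, div_one] at this
    calc _ ≤ ENNReal.ofReal (A * (2 * (2 * (k + 1)) ^ (k + 1))) * 1 := by
          rw [mul_one]
          exact ENNReal.ofReal_le_ofReal this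
      _ ≤ _ := mul_le_mul_right le_self_add _
  · have := minkowskiMin_le_of_forall_le hQ hA hN hpos (hsq _ hpos.le le_rfl)
    have hterm : truncInvPow k (Q *ᵥ toR z₀) = ENNReal.ofReal ((‖Q *ᵥ toR z₀‖ ^ k)⁻¹) := by
      rw [truncInvPow, if_pos h1.le, ENNReal.ofReal_inv_of_pos (by positivity)]
    calc _ ≤ ENNReal.ofReal (A * (2 * (2 * (k + 1)) ^ (k + 1))) *
          truncInvPow k (Q *ᵥ toR z₀) := by
          rw [hterm, ← ENNReal.ofReal_mul (by positivity), mul_assoc, ← div_eq_mul_inv]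
          exact ENNReal.ofReal_le_ofReal this
      _ ≤ _ := by
          refine mul_le_mul_right (le_add_left ?_) _
          exact ENNReal.le_tsum (f := fun z : {z : Fin (k + 1) → ℤ // z ≠ 0} =>
            truncInvPow k (Q *ᵥ toR z.1)) ⟨z₀, hz₀⟩

lemma mnorm_transpose_mul_self_eq_sqrt {d : ℕ} (S : Matrix (Fin d) (Fin d) ℝ) (u : Fin d → ℝ) :
    mnorm (Sᵀ * S) u = √((S *ᵥ u) ⬝ᵥ (S *ᵥ u)) := by
  rw [mnorm, mdot, ← mulVec_mulVec, dotProduct_mulVec, vecMul_transpose]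

lemma measurable_minkowskiMin_conj (M : Matrix (Fin (k + 1)) (Fin (k + 1)) ℝ) :
    Measurable fun R : orthogonalGroup (Fin (k + 1)) ℝ =>
      minkowskiMin ((R : Matrix (Fin (k + 1)) (Fin (k + 1)) ℝ)ᵀ * M * R.1) (k + 1) := by
  simp_rw [minkowskiMin_eq_iInf _ k rfl]
  refine Measurable.iInf fun u => Continuous.measurable ?_
  unfold mnorm mdot
  fun_prop

lemma lintegral_const_mul_one_add_tsum {α ι : Type*} [Countable ι] [MeasurableSpace α]
    {μ : Measure α} [IsProbabilityMeasure μ] {c : ENNReal} (hc : c ≠ ⊤) {f : ι → α → ENNReal}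
    (hf : ∀ i, Measurable (f i)) :
    ∫⁻ x, c * (1 + ∑' i, f i x) ∂μ = c * (1 + ∑' i, ∫⁻ x, f i x ∂μ) := by
  rw [lintegral_const_mul' _ _ hc, lintegral_add_left measurable_const,
    lintegral_tsum fun i => (hf i).aemeasurable]
  simp

lemma lintegral_minkowskiMin_conj_le {S : Matrix (Fin (k + 1)) (Fin (k + 1)) ℝ}
    (hS : |S.det| = 1) {A : ℝ} (hA : 0 ≤ A) :
    ∫⁻ R : orthogonalGroup (Fin (k + 1)) ℝ, ENNReal.ofReal (minkowskiMin
        ((R : Matrix (Fin (k + 1)) (Fin (k + 1)) ℝ)ᵀ * ((A • S)ᵀ * (A • S)) * R.1) (k + 1))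
        ∂orthogonalHaar (k + 1) ≤
      ENNReal.ofReal (A * (2 * (2 * (k + 1)) ^ (k + 1))) *
        (1 + ENNReal.ofReal (((k + 1 : ℕ) + 1 : ℝ) ^ (k + 1)) * ∫⁻ y, truncInvPow k y) := by
  have hS0 : S.det ≠ 0 := fun h0 => by simp [h0] at hS
  have hF : Measurable fun x => truncInvPow k (S *ᵥ x) :=
    (measurable_truncInvPow k).comp (Continuous.measurable (by fun_prop))
  have hmul : ∀ (R : orthogonalGroup (Fin (k + 1)) ℝ) (x : Fin (k + 1) → ℝ),
      (S * (R : Matrix (Fin (k + 1)) (Fin (k + 1)) ℝ)) *ᵥ x = S *ᵥ (R.1 *ᵥ x) := fun R x =>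
    (mulVec_mulVec _ _ _).symm
  have hterm : ∀ z : Fin (k + 1) → ℤ, Measurable fun R : orthogonalGroup (Fin (k + 1)) ℝ =>
      truncInvPow k (S *ᵥ (R.1 *ᵥ toR z)) := fun z =>
    hF.comp (Continuous.measurable (by fun_prop))
  calc _ ≤ ∫⁻ R : orthogonalGroup (Fin (k + 1)) ℝ,
        ENNReal.ofReal (A * (2 * (2 * (k + 1)) ^ (k + 1))) *
          (1 + ∑' z : {z : Fin (k + 1) → ℤ // z ≠ 0}, truncInvPow k (S *ᵥ (R.1 *ᵥ toR z.1)))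
          ∂orthogonalHaar (k + 1) := by
        refine lintegral_mono fun R => ?_
        have hdet : |(S * (R : Matrix (Fin (k + 1)) (Fin (k + 1)) ℝ)).det| = 1 := by
          rw [det_mul, abs_mul, hS, abs_det_orthogonal, mul_one]
        simp_rw [← hmul]
        refine ofReal_minkowskiMin_le_tsum hdet hA fun x => ?_
        have : (R : Matrix (Fin (k + 1)) (Fin (k + 1)) ℝ)ᵀ * ((A • S)ᵀ * (A • S)) * R.1 =
            ((A • S) * R.1)ᵀ * ((A • S) * R.1) := by
          rw [transpose_mul]
          simp only [Matrix.mul_assoc]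
        rw [this, mnorm_transpose_mul_self_eq_sqrt, Matrix.smul_mul, smul_mulVec, smul_dotProduct,
          dotProduct_smul, smul_eq_mul, smul_eq_mul, ← mul_assoc,
          Real.sqrt_mul (mul_self_nonneg A), Real.sqrt_mul_self hA]
    _ = ENNReal.ofReal (A * (2 * (2 * (k + 1)) ^ (k + 1))) *
          (1 + ∑' z : {z : Fin (k + 1) → ℤ // z ≠ 0}, ∫⁻ R : orthogonalGroup (Fin (k + 1)) ℝ,
            truncInvPow k (S *ᵥ (R.1 *ᵥ toR z.1)) ∂orthogonalHaar (k + 1)) := by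
        exact lintegral_const_mul_one_add_tsum ENNReal.ofReal_ne_top fun z => hterm z.1
    _ ≤ _ := by
        refine mul_le_mul_right (add_le_add_right ?_ _) _
        -- The function `F ∘ S` need not be radial; decreasing along rays suffices.
        refine (tsum_lintegral_orthogonal_le hF fun x t h0 h1 => ?_).trans_eq ?_
        · rw [mulVec_smul]
          exact truncInvPow_le_smul _ h0 h1
        · rw [lintegral_comp_mulVec hS0 (measurable_truncInvPow k), abs_inv, hS]
          simp

theorem exists_integral_minkowskiMin_le (k : ℕ) :
    ∃ C : ℝ, ∀ M : Matrix (Fin (k + 1)) (Fin (k + 1)) ℝ, M.PosDef →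
      Integrable (fun R : orthogonalGroup (Fin (k + 1)) ℝ =>
        minkowskiMin ((R : Matrix (Fin (k + 1)) (Fin (k + 1)) ℝ)ᵀ * M * R.1) (k + 1))
        (orthogonalHaar (k + 1)) ∧
      ∫ R : orthogonalGroup (Fin (k + 1)) ℝ,
          minkowskiMin ((R : Matrix (Fin (k + 1)) (Fin (k + 1)) ℝ)ᵀ * M * R.1) (k + 1)
          ∂orthogonalHaar (k + 1) ≤
        C * M.det ^ ((1 : ℝ) / (2 * ((k + 1 : ℕ) : ℝ))) := by
  set B : ENNReal :=
    1 + ENNReal.ofReal (((k + 1 : ℕ) + 1 : ℝ) ^ (k + 1)) * ∫⁻ y, truncInvPow k y with hBdef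
  have hB : B ≠ ⊤ := by
    have := (lintegral_truncInvPow_lt_top k).ne
    finiteness
  refine ⟨2 * (2 * (k + 1)) ^ (k + 1) * B.toReal, fun M hM => ?_⟩
  obtain ⟨S, hMS, hS⟩ := exists_eq_transpose_mul_self hM
  have hdet : M.det = S.det ^ 2 := by rw [hMS, det_mul, det_transpose, sq]
  -- This scale makes `A⁻¹ S` have determinant `±1`.
  set A : ℝ := M.det ^ ((1 : ℝ) / (2 * ((k + 1 : ℕ) : ℝ))) with hAdef
  have hA : 0 < A := Real.rpow_pos_of_pos hM.det_pos _
  have hApow : A ^ (k + 1) = |S.det| := by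
    rw [hAdef, ← Real.rpow_natCast, ← Real.rpow_mul hM.det_pos.le,
      show (1 : ℝ) / (2 * ((k + 1 : ℕ) : ℝ)) * ((k + 1 : ℕ) : ℝ) = 1 / 2 by
        push_cast
        field_simp,
      ← Real.sqrt_eq_rpow, hdet, Real.sqrt_sq_eq_abs]
  have hS' : |(A⁻¹ • S).det| = 1 := by
    rw [det_smul, Fintype.card_fin, abs_mul, ← hApow, abs_of_pos (by positivity), inv_pow,
      inv_mul_cancel₀ (by positivity)]
  have hM' : M = (A • (A⁻¹ • S))ᵀ * (A • (A⁻¹ • S)) := by rw [smul_inv_smul₀ hA.ne', hMS]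
  have hle := lintegral_minkowskiMin_conj_le hS' hA.le
  rw [← hM', ← hBdef] at hle
  have hfin : ENNReal.ofReal (A * (2 * (2 * (k + 1)) ^ (k + 1))) * B ≠ ⊤ :=
    ENNReal.mul_ne_top ENNReal.ofReal_ne_top hB
  have hmeas := measurable_minkowskiMin_conj M
  have hnonneg : 0 ≤ᵐ[orthogonalHaar (k + 1)] fun R : orthogonalGroup (Fin (k + 1)) ℝ =>
      minkowskiMin ((R : Matrix (Fin (k + 1)) (Fin (k + 1)) ℝ)ᵀ * M * R.1) (k + 1) :=
    Filter.Eventually.of_forall fun R => minkowskiMin_nonneg _ _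
  refine ⟨⟨hmeas.aestronglyMeasurable, ?_⟩, ?_⟩
  · rw [hasFiniteIntegral_iff_ofReal hnonneg]
    exact hle.trans_lt hfin.lt_top
  · rw [integral_eq_lintegral_of_nonneg_ae hnonneg hmeas.aestronglyMeasurable]
    refine (ENNReal.toReal_mono hfin hle).trans_eq ?_
    rw [ENNReal.toReal_mul, ENNReal.toReal_ofReal (by positivity)]
    ring

end Average

end FastMarching

theorem theorem2 :
    -- every reduced mesh with vertices `ε_1 u_1 + ⋯ + ε_d u_d` (`d ≤ 3`)
    (∀ d : ℕ, 1 ≤ d → d ≤ 3 → ∀ M : Matrix (Fin d) (Fin d) ℝ, M.PosDef →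
      ∀ u : Fin d → (Fin d → ℤ), FastMarching.IsReducedBasis M u →
      ∀ T : Set (Set (Fin d → ℝ)),
        FastMarching.IsReducedMesh M T → FastMarching.HasSignVertices u T →
        FastMarching.boundingRadius M T ≤ (d : ℝ) * FastMarching.minkowskiMin M d) ∧
    -- the explicit meshes in dimensions two, three and four
    (∀ M : Matrix (Fin 2) (Fin 2) ℝ, M.PosDef →
      ∀ T : Set (Set (Fin 2 → ℝ)), FastMarching.IsConstructedMesh₂ M T →
        FastMarching.boundingRadius M T ≤ 2 * FastMarching.minkowskiMin M 2) ∧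
    (∀ M : Matrix (Fin 3) (Fin 3) ℝ, M.PosDef →
      ∀ T : Set (Set (Fin 3 → ℝ)), FastMarching.IsConstructedMesh₃ M T →
        FastMarching.boundingRadius M T ≤ 3 * FastMarching.minkowskiMin M 3) ∧
    (∀ M : Matrix (Fin 4) (Fin 4) ℝ, M.PosDef →
      ∀ u : Fin 4 → (Fin 4 → ℤ), FastMarching.IsReducedBasis M u →
        FastMarching.boundingRadius M (FastMarching.mesh₄ u) ≤
          5 * FastMarching.minkowskiMin M 4) ∧
    -- the average of the last minimum over the orthogonal group, in every dimension
    (∀ d : ℕ, 1 ≤ d → ∃ C : ℝ, ∀ M : Matrix (Fin d) (Fin d) ℝ, M.PosDef →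
      MeasureTheory.Integrable
        (fun R : Matrix.orthogonalGroup (Fin d) ℝ =>
          FastMarching.minkowskiMin
            ((R : Matrix (Fin d) (Fin d) ℝ).transpose * M * (R : Matrix (Fin d) (Fin d) ℝ)) d)
        (FastMarching.orthogonalHaar d) ∧
      ∫ R : Matrix.orthogonalGroup (Fin d) ℝ,
          FastMarching.minkowskiMin
            ((R : Matrix (Fin d) (Fin d) ℝ).transpose * M * (R : Matrix (Fin d) (Fin d) ℝ)) d
          ∂(FastMarching.orthogonalHaar d) ≤
        C * M.det ^ ((1 : ℝ) / (2 * (d : ℝ)))) := by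
  refine ⟨?_, fun M hM T hT => FastMarching.boundingRadius_constructedMesh₂_le hM hT,
    fun M hM T hT => FastMarching.boundingRadius_constructedMesh₃_le hM hT,
    fun M hM u hu => FastMarching.boundingRadius_mesh₄_le hM hu, ?_⟩
  · intro d _ _ M hM u hu T _ hT
    exact FastMarching.boundingRadius_le_of_hasSignVertices hM hu hT
  · intro d hd
    obtain ⟨k, rfl⟩ : ∃ k, d = k + 1 := ⟨d - 1, by lia⟩
    exact FastMarching.exists_integral_minkowskiMin_le k
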